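/- An inverse monoid is a monoid $M$ in which every element $s$ has a unique inverse $s^{-1}$, i.e. a unique element with $ss^{-1}s=s$ and $s^{-1}ss^{-1}=s^{-1}$. A congruence on $M$ is idempotent-pure if it never relates an idempotent to a non-idempotent, and $M$ is $E$-disjunctive if equality is its only idempotent-pure congruence. Elements $a,b\in M$ are $\mathscr{J}$-related if $MaM=MbM$. Let $\mathfrak{C}=\{0,1\}^{\omega}$ be the set of infinite binary sequences and, for a finite word $w\in\{0,1\}^*$, let $w\mathfrak{C}$ be the set of sequences with prefix $w$. A finite set $F\subseteq\{0,1\}^*$ is a complete antichain if the sets $w\mathfrak{C}$ $(w\in F)$ partition $\mathfrak{C}$. Thompson's group $V$ is the group of all maps $f\colon\mathfrak{C}\to\mathfrak{C}$ of the form $wv\mapsto \phi(w)v$ $(w\in F_1,\ v\in\mathfrak{C})$, where $\phi\colon F_1\to F_2$ is a bijection between complete antichains. **Theorem.** There exists a finitely generated $E$-disjunctive inverse monoid with infinitely many $\mathscr{J}$-classes. More precisely, let $M$ be the inverse submonoid of the symmetric inverse monoid on $\mathfrak{C}$ (all bijections between subsets of $\mathfrak{C}$, under composition of partial maps) generated by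 Thompson's group $V$, the identity function on $1\mathfrak{C}$ and the identity function on $\{1^n0^\omega : n\ge 0\}$. Then $M$ is finitely generated as an inverse monoid, is $E$-disjunctive, and has infinitely many $\mathscr{J}$-classes. -/

import Mathlib

/-! ### Inverse monoids -/

/-- An inverse monoid: every element `s` has a unique inverse, i.e. a unique `t` with
`s * t * s = s` and `t * s * t = t`; it is written `s⁻¹`. -/
class InverseMonoid (M : Type*) extends Monoid M, Inv M where
  mul_inv_mul : ∀ s : M, s * s⁻¹ * s = s
  inv_mul_inv : ∀ s : M, s⁻¹ * s * s⁻¹ = s⁻¹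
  inv_unique : ∀ s t : M, s * t * s = s → t * s * t = t → t = s⁻¹

/-- A congruence is idempotent-pure if it never relates a non-idempotent to an idempotent. -/
def IsIdempotentPure {M : Type*} [Mul M] (c : Con M) : Prop :=
  ∀ s e : M, c s e → IsIdempotentElem e → IsIdempotentElem s

/-- `M` is `E`-disjunctive if its only idempotent-pure congruence is equality. -/
def IsEDisjunctive (M : Type*) [InverseMonoid M] : Prop :=
  ∀ c : Con M, IsIdempotentPure c → c = ⊥

/-- The principal two-sided ideal `M a M`. -/
def principalIdeal {M : Type*} [Monoid M] (a : M) : Set M :=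
  {z | ∃ x y : M, z = x * a * y}

/-- Green's relation `𝒥`: two elements are related if they generate the same principal ideal. -/
def greenJ (M : Type*) [Monoid M] : Setoid M where
  r a b := principalIdeal a = principalIdeal b
  iseqv := ⟨fun _ => rfl, fun h => h.symm, fun h k => h.trans k⟩

/-- The type of `𝒥`-classes of `M`. -/
abbrev JClasses (M : Type*) [Monoid M] : Type _ := Quotient (greenJ M)

/-- Inverse submonoids: submonoids closed under taking inverses. -/
structure InverseSubmonoid (M : Type*) [InverseMonoid M] extends Submonoid M where
  inv_mem' : ∀ x ∈ carrier, x⁻¹ ∈ carrier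

namespace InverseSubmonoid

/-- The inverse submonoid generated by a set `A`: the intersection of all inverse submonoids
that contain `A`. -/
def closure {M : Type*} [InverseMonoid M] (A : Set M) : InverseSubmonoid M where
  carrier := {x | ∀ N : InverseSubmonoid M, A ⊆ N.carrier → x ∈ N.carrier}
  mul_mem' := fun ha hb N hN => N.mul_mem' (ha N hN) (hb N hN)
  one_mem' := fun N _ => N.one_mem'
  inv_mem' := fun _ hx N hN => N.inv_mem' _ (hx N hN)

/-- An inverse submonoid is an inverse monoid with the restricted operations. -/
instance {M : Type*} [InverseMonoid M] (N : InverseSubmonoid M) :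
    InverseMonoid N.toSubmonoid where
  inv x := ⟨(x : M)⁻¹, N.inv_mem' _ x.2⟩
  mul_inv_mul s := Subtype.ext (InverseMonoid.mul_inv_mul (s : M))
  inv_mul_inv s := Subtype.ext (InverseMonoid.inv_mul_inv (s : M))
  inv_unique s t h k := Subtype.ext
    (InverseMonoid.inv_unique (s : M) (t : M) (congrArg Subtype.val h) (congrArg Subtype.val k))

end InverseSubmonoid

/-- `M` is finitely generated as an inverse monoid. -/
def InverseMonoid.FinitelyGenerated (M : Type*) [InverseMonoid M] : Prop :=
  ∃ A : Set M, A.Finite ∧ ∀ x : M, x ∈ (InverseSubmonoid.closure A).carrier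

/-! ### The symmetric inverse monoid -/

theorem PEquiv.trans_symm_trans_self {X : Type*} (f : X ≃. X) :
    (f.trans f.symm).trans f = f := by
  refine PEquiv.ext fun x => Option.ext fun y => ?_
  change y ∈ ((f.trans f.symm).trans f) x ↔ y ∈ f x
  rw [PEquiv.mem_trans]
  constructor
  · rintro ⟨b, hb, h3⟩
    obtain ⟨c, h1, h2⟩ := (PEquiv.mem_trans _ _ _ _).1 hb
    have e := PEquiv.inj f h1 (f.mem_iff_mem.1 h2)
    subst e
    exact h3
  · intro h
    exact ⟨x, (PEquiv.mem_trans _ _ _ _).2 ⟨y, h, f.mem_iff_mem.2 h⟩, h⟩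

theorem PEquiv.mem_of_trans_trans_self {X : Type*} {s t : X ≃. X} (h : (s.trans t).trans s = s)
    {x y : X} (hy : y ∈ s x) : x ∈ t y := by
  have hy' := hy
  rw [← h, PEquiv.mem_trans] at hy'
  obtain ⟨b, hb, h3⟩ := hy'
  obtain ⟨c, h1, h2⟩ := (PEquiv.mem_trans _ _ _ _).1 hb
  have e1 := PEquiv.inj s h3 hy
  have e2 := Option.mem_unique h1 hy
  subst e1
  subst e2
  exact h2

/-- The symmetric inverse monoid on `X`: all bijections between subsets of `X`. -/
def SymInvMonoid (X : Type*) : Type _ := X ≃. X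

/-- The product `f * g` is the composite "first `f`, then `g`" of partial maps. -/
instance (X : Type*) : InverseMonoid (SymInvMonoid X) where
  mul f g := PEquiv.trans f g
  one := PEquiv.refl X
  inv f := PEquiv.symm f
  mul_assoc f g h := PEquiv.trans_assoc f g h
  one_mul f := PEquiv.refl_trans f
  mul_one f := PEquiv.trans_refl f
  mul_inv_mul s := PEquiv.trans_symm_trans_self s
  inv_mul_inv s := PEquiv.trans_symm_trans_self (PEquiv.symm s)
  inv_unique s t h k := PEquiv.ext fun _ => Option.ext fun _ =>
    ⟨fun hy => (PEquiv.mem_iff_mem s).2 (PEquiv.mem_of_trans_trans_self k hy),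
      fun hx => PEquiv.mem_of_trans_trans_self h ((PEquiv.mem_iff_mem s).1 hx)⟩

open Classical in
/-- The identity function on a subset of `X`, as an element of the symmetric inverse monoid. -/
noncomputable def SymInvMonoid.idOn {X : Type*} (A : Set X) : SymInvMonoid X := PEquiv.ofSet A

/-- A permutation of `X`, as an element of the symmetric inverse monoid. -/
def SymInvMonoid.ofPerm {X : Type*} (f : Equiv.Perm X) : SymInvMonoid X := Equiv.toPEquiv f

/-! ### Cantor space and Thompson's group `V` -/

/-- The underlying set of Cantor space: infinite sequences of `0`s (`false`) and `1`s (`true`).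
For a finite word `w : List Bool` and `x : Cantor`, the sequence `w x` is `w ++ₛ x`. -/
abbrev Cantor : Type := Stream' Bool

/-- The cone `wℭ` of all infinite sequences with prefix `w`. -/
def cone (w : List Bool) : Set Cantor := {x | ∃ v : Cantor, x = w ++ₛ v}

/-- A finite set `F` of words is a complete antichain if the cones `wℭ`, `w ∈ F`,
partition Cantor space. -/
def IsCompleteAntichain (F : Finset (List Bool)) : Prop :=
  ∀ x : Cantor, ∃! w : List Bool, w ∈ F ∧ x ∈ cone w

/-- `f` is the prefix exchange map `w v ↦ φ(w) v` (`w ∈ F₁`, `v ∈ ℭ`) induced by some bijection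
`φ : F₁ → F₂` between complete antichains. -/
def IsPrefixExchange (f : Cantor → Cantor) : Prop :=
  ∃ F₁ F₂ : Finset (List Bool), IsCompleteAntichain F₁ ∧ IsCompleteAntichain F₂ ∧
    ∃ φ : F₁ ≃ F₂, ∀ (w : F₁) (v : Cantor), f ((w : List Bool) ++ₛ v) = (φ w : List Bool) ++ₛ v

/-- (The set of elements of) Thompson's group `V`. -/
def thompsonV : Set (Equiv.Perm Cantor) := {f | IsPrefixExchange f}

/-- The set `{1ⁿ0^ω : n ≥ 0}`. -/
def onesThenZeros : Set Cantor :=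
  {x | ∃ n : ℕ, x = List.replicate n true ++ₛ Stream'.const false}

/-- The inverse submonoid of the symmetric inverse monoid on Cantor space generated by `V`, the
identity on `1ℭ` and the identity on `{1ⁿ0^ω : n ≥ 0}`. -/
noncomputable def thompsonInverseMonoid : InverseSubmonoid (SymInvMonoid Cantor) :=
  InverseSubmonoid.closure
    (SymInvMonoid.ofPerm '' thompsonV ∪
      {SymInvMonoid.idOn (cone [true]), SymInvMonoid.idOn onesThenZeros})

/-! ### Words, cones and prefixes -/

/-! Finite generation reduces to that of `V`. A table of prefix replacements can be corrected by
cone swaps until two sibling rows merge, so cone swaps generate `V`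
(`HasTable.mem_closure_shortSwaps`). A swap involving a long word is a conjugate, by a short swap,
of a swap with smaller total length (`IsConeSwap.mem_closure_shortSwaps`). Hence the finitely many
swaps of words of length at most three suffice.

For the `𝒥`-classes, the cardinality of the domain cannot increase on multiplying from either side.
Meeting the set of all `1ⁿ0^ω` with its image under a suitable swap leaves exactly `n + 1` points,
so `M` contains idempotents of infinitely many finite ranks.

For `E`-disjunctivity, call a sequence rational if it ends in `0^ω`. Every element of `M` is either
a local prefix replacement between clopen sets or a bijection between nowhere dense sets of rational
points (`isClopenType_or_isThinType`). Elements of these two types are determined by the pairs of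
rational points they relate (`maps_of_maps_on_eventuallyZero`). An idempotent-pure congruence
preserves each such pair (`IsIdempotentPure.maps_of_maps`): multiplying by one-point idempotents
would otherwise relate a rank-one map to the empty map, and so would its product with a
fixed-point-free element of `V`. Both rank-one maps would then be idempotent, which is impossible.
-/

theorem append_stream_eq_append_stream {u w : List Bool} {x y : Cantor}
    (h : u ++ₛ x = w ++ₛ y) :
    (∃ k, w = u ++ k ∧ x = k ++ₛ y) ∨ ∃ k, u = w ++ k ∧ y = k ++ₛ x := by
  induction u generalizing w with
  | nil => exact Or.inl ⟨w, rfl, h⟩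
  | cons a u ih =>
    cases w with
    | nil => exact Or.inr ⟨a :: u, rfl, h.symm⟩
    | cons b w =>
      rw [Stream'.cons_append_stream, Stream'.cons_append_stream] at h
      have h1 : a = b := congrArg Stream'.head h
      have h2 : u ++ₛ x = w ++ₛ y := congrArg Stream'.tail h
      subst h1
      rcases ih h2 with ⟨k, rfl, rfl⟩ | ⟨k, rfl, rfl⟩
      · exact Or.inl ⟨k, rfl, rfl⟩
      · exact Or.inr ⟨k, rfl, rfl⟩

theorem append_mem_cone (u : List Bool) (v : Cantor) : u ++ₛ v ∈ cone u := ⟨v, rfl⟩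

theorem mem_cone_of_prefix {u w : List Bool} (h : u <+: w) {x : Cantor} (hx : x ∈ cone w) :
    x ∈ cone u := by
  obtain ⟨k, rfl⟩ := h
  obtain ⟨v, rfl⟩ := hx
  exact ⟨k ++ₛ v, by simp⟩

theorem prefix_or_prefix_of_mem_cone {u w : List Bool} {x : Cantor} (hu : x ∈ cone u)
    (hw : x ∈ cone w) : u <+: w ∨ w <+: u := by
  obtain ⟨a, rfl⟩ := hu
  obtain ⟨b, hb⟩ := hw
  rcases append_stream_eq_append_stream hb with ⟨k, rfl, -⟩ | ⟨k, rfl, -⟩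
  · exact Or.inl ⟨k, rfl⟩
  · exact Or.inr ⟨k, rfl⟩

/-- Two words are incomparable if neither is a prefix of the other. -/
def Incomparable (u w : List Bool) : Prop := ¬ u <+: w ∧ ¬ w <+: u

theorem Incomparable.symm {u w : List Bool} (h : Incomparable u w) : Incomparable w u :=
  ⟨h.2, h.1⟩

theorem Incomparable.not_mem_cone {u w : List Bool} (h : Incomparable u w) {x : Cantor}
    (hx : x ∈ cone u) : x ∉ cone w := fun hw =>
  (prefix_or_prefix_of_mem_cone hx hw).elim h.1 h.2

theorem Incomparable.extend_left {u w u' : List Bool} (h : Incomparable u w) (hu : u <+: u') :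
    Incomparable u' w :=
  ⟨fun h' => h.1 (hu.trans h'), fun h' => (List.prefix_or_prefix_of_prefix hu h').elim h.1 h.2⟩

theorem incomparable_of_length_eq {u w : List Bool} (h : u.length = w.length) (hne : u ≠ w) :
    Incomparable u w :=
  ⟨fun k => hne (k.eq_of_length h), fun k => hne (k.eq_of_length h.symm).symm⟩

theorem eq_nil_of_surjective_append {u : List Bool}
    (h : ∀ x : Cantor, ∃ v : Cantor, u ++ₛ v = x) : u = [] := by
  cases u with
  | nil => rfl
  | cons a u =>
    obtain ⟨v, hv⟩ := h (Stream'.const (!a))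
    have : a = !a := congrArg Stream'.head hv
    cases a <;> simp at this

/-! ### Swaps of two cones -/

/-- `g` exchanges the cones of `a` and `b` by exchanging the prefixes, and fixes the rest. -/
def IsConeSwap (a b : List Bool) (g : Equiv.Perm Cantor) : Prop :=
  (∀ v, g (a ++ₛ v) = b ++ₛ v) ∧ (∀ v, g (b ++ₛ v) = a ++ₛ v) ∧
    ∀ x, x ∉ cone a → x ∉ cone b → g x = x

theorem IsConeSwap.symm {a b : List Bool} {g : Equiv.Perm Cantor} (h : IsConeSwap a b g) :
    IsConeSwap b a g := ⟨h.2.1, h.1, fun x hb ha => h.2.2 x ha hb⟩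

theorem IsConeSwap.eq {a b : List Bool} {g g' : Equiv.Perm Cantor} (h : IsConeSwap a b g)
    (h' : IsConeSwap a b g') : g = g' := by
  ext1 x
  by_cases ha : x ∈ cone a
  · obtain ⟨v, rfl⟩ := ha
    rw [h.1, h'.1]
  by_cases hb : x ∈ cone b
  · obtain ⟨v, rfl⟩ := hb
    rw [h.2.1, h'.2.1]
  rw [h.2.2 x ha hb, h'.2.2 x ha hb]

theorem Incomparable.exists_isConeSwap {a b : List Bool} (h : Incomparable a b) :
    ∃ g, IsConeSwap a b g := by
  classical
  let s : Cantor → Cantor := fun x =>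
    if x ∈ cone a then b ++ₛ x.drop a.length
    else if x ∈ cone b then a ++ₛ x.drop b.length else x
  have h1 : ∀ v, s (a ++ₛ v) = b ++ₛ v := fun v => by
    simp only [s, if_pos (append_mem_cone a v), Stream'.drop_append_stream]
  have h2 : ∀ v, s (b ++ₛ v) = a ++ₛ v := fun v => by
    simp only [s, if_pos (append_mem_cone b v), if_neg (h.symm.not_mem_cone (append_mem_cone b v)),
      Stream'.drop_append_stream]
  have h3 : ∀ x, x ∉ cone a → x ∉ cone b → s x = x := fun x ha hb => by
    simp only [s, if_neg ha, if_neg hb]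
  have hs : Function.Involutive s := fun x => by
    by_cases ha : x ∈ cone a
    · obtain ⟨v, rfl⟩ := ha
      rw [h1, h2]
    by_cases hb : x ∈ cone b
    · obtain ⟨v, rfl⟩ := hb
      rw [h2, h1]
    rw [h3 x ha hb, h3 x ha hb]
  exact ⟨hs.toPerm, h1, h2, h3⟩

theorem IsConeSwap.conj {a b a' b' : List Bool} {g h : Equiv.Perm Cantor} (hg : IsConeSwap a b g)
    (ha : ∀ v, h (a ++ₛ v) = a' ++ₛ v) (hb : ∀ v, h (b ++ₛ v) = b' ++ₛ v) :
    IsConeSwap a' b' (h * g * h⁻¹) := by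
  have hinv : ∀ x, h⁻¹ (h x) = x := h.symm_apply_apply
  refine ⟨fun v => ?_, fun v => ?_, fun x hx hx' => ?_⟩
  · rw [← ha, ← hb, Equiv.Perm.mul_apply, hinv, Equiv.Perm.mul_apply, hg.1]
  · rw [← ha, ← hb, Equiv.Perm.mul_apply, hinv, Equiv.Perm.mul_apply, hg.2.1]
  · obtain ⟨y, rfl⟩ := h.surjective x
    rw [Equiv.Perm.mul_apply, hinv, Equiv.Perm.mul_apply, hg.2.2]
    · rintro ⟨v, rfl⟩
      exact hx ⟨v, ha v⟩
    · rintro ⟨v, rfl⟩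
      exact hx' ⟨v, hb v⟩

theorem finite_length_le (n : ℕ) : {w : List Bool | w.length ≤ n}.Finite :=
  List.finite_length_le Bool n

theorem IsConeSwap.mem_thompsonV {a b : List Bool} {g : Equiv.Perm Cantor}
    (hg : IsConeSwap a b g) (hab : Incomparable a b) : g ∈ thompsonV := by
  let n := max a.length b.length
  -- The full level `n`, with the words below `a` and below `b` collapsed to `a` and `b`. Exchanging
  -- `a` and `b` permutes this antichain and induces `g`.
  let S : Set (List Bool) := {w | w = a ∨ w = b ∨ (w.length = n ∧ ¬ a <+: w ∧ ¬ b <+: w)}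
  have hS : S.Finite := (finite_length_le n).subset <| by
    rintro w (rfl | rfl | h)
    · exact le_max_left w.length b.length
    · exact le_max_right a.length w.length
    · exact h.1.le
  have hmem : ∀ w, w ∈ hS.toFinset ↔ w ∈ S := fun w => hS.mem_toFinset
  have hF : IsCompleteAntichain hS.toFinset := by
    intro x
    simp only [hmem]
    by_cases ha : x ∈ cone a
    · refine ⟨a, ⟨Or.inl rfl, ha⟩, ?_⟩
      rintro w ⟨rfl | rfl | ⟨hl, h1, h2⟩, hw⟩
      · rfl
      · exact absurd hw (hab.not_mem_cone ha)
      · rcases prefix_or_prefix_of_mem_cone ha hw with h | h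
        · exact absurd h h1
        · exact h.eq_of_length (le_antisymm h.length_le (hl ▸ le_max_left _ _))
    by_cases hb : x ∈ cone b
    · refine ⟨b, ⟨Or.inr (Or.inl rfl), hb⟩, ?_⟩
      rintro w ⟨rfl | rfl | ⟨hl, h1, h2⟩, hw⟩
      · exact absurd hw ha
      · rfl
      · rcases prefix_or_prefix_of_mem_cone hb hw with h | h
        · exact absurd h h2
        · exact h.eq_of_length (le_antisymm h.length_le (hl ▸ le_max_right _ _))
    have hx : x ∈ cone (x.take n) := ⟨x.drop n, (Stream'.append_take_drop n x).symm⟩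
    refine ⟨x.take n, ⟨Or.inr (Or.inr ⟨Stream'.length_take _ _, fun h => ha
      (mem_cone_of_prefix h hx), fun h => hb (mem_cone_of_prefix h hx)⟩), hx⟩, ?_⟩
    rintro w ⟨rfl | rfl | ⟨hl, h1, h2⟩, hw⟩
    · exact absurd hw ha
    · exact absurd hw hb
    · rcases prefix_or_prefix_of_mem_cone hx hw with h | h
      · exact (h.eq_of_length (by rw [hl, Stream'.length_take])).symm
      · exact h.eq_of_length (by rw [hl, Stream'.length_take])
  have hne : ∀ w ∈ S, w ≠ a → w ≠ b → ∀ v, g (w ++ₛ v) = w ++ₛ v := by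
    rintro w (rfl | rfl | ⟨hl, h1, h2⟩) h h' v
    · exact absurd rfl h
    · exact absurd rfl h'
    · refine hg.2.2 _ (Incomparable.not_mem_cone ⟨fun k => h ?_, h1⟩ (append_mem_cone w v))
        (Incomparable.not_mem_cone ⟨fun k => h' ?_, h2⟩ (append_mem_cone w v))
      · exact k.eq_of_length (le_antisymm k.length_le (hl ▸ le_max_left _ _))
      · exact k.eq_of_length (le_antisymm k.length_le (hl ▸ le_max_right _ _))
  have hswap : ∀ w, w ∈ hS.toFinset ↔ Equiv.swap a b w ∈ hS.toFinset := by
    intro w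
    simp only [hmem]
    by_cases h : w = a
    · subst h
      simp [S]
    by_cases h' : w = b
    · subst h'
      simp [S]
    rw [Equiv.swap_apply_of_ne_of_ne h h']
  refine ⟨hS.toFinset, hS.toFinset, hF, hF, (Equiv.swap a b).subtypeEquiv hswap, ?_⟩
  rintro ⟨w, hw⟩ v
  change g (w ++ₛ v) = Equiv.swap a b w ++ₛ v
  by_cases h : w = a
  · subst h
    rw [Equiv.swap_apply_left, hg.1]
  by_cases h' : w = b
  · subst h'
    rw [Equiv.swap_apply_right, hg.2.1]
  rw [Equiv.swap_apply_of_ne_of_ne h h', hne w ((hmem w).1 hw) h h']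

/-! ### Thompson's group `V` is finitely generated -/

/-- The swaps of two cones of words of length at most three. -/
def shortSwaps : Set (Equiv.Perm Cantor) :=
  {g | ∃ a b : List Bool, Incomparable a b ∧ a.length ≤ 3 ∧ b.length ≤ 3 ∧ IsConeSwap a b g}

theorem finite_shortSwaps : shortSwaps.Finite := by
  have h : (⋃ p ∈ {w : List Bool | w.length ≤ 3} ×ˢ {w : List Bool | w.length ≤ 3},
      {g | IsConeSwap p.1 p.2 g}).Finite :=
    ((finite_length_le 3).prod (finite_length_le 3)).biUnion fun p _ =>
      Set.Subsingleton.finite fun _ hg _ hg' => IsConeSwap.eq hg hg'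
  refine h.subset ?_
  rintro g ⟨a, b, -, ha, hb, hg⟩
  exact Set.mem_biUnion (x := (a, b)) ⟨ha, hb⟩ hg

theorem shortSwaps_subset_thompsonV : shortSwaps ⊆ thompsonV := by
  rintro g ⟨a, b, hab, -, -, hg⟩
  exact hg.mem_thompsonV hab

/-- Supplies the conjugating swap for the length reduction: `d` is one letter shorter than the
prefix `c` of `a`. Among the four words of length two, one is excluded by `a` and at most one by a
`b` of length at least two. A `b` of length one excludes two, but then its letter differs from the
first letter of `a`, which leaves the sibling of the length-two prefix of `a`. -/
theorem Incomparable.exists_shorter {a b : List Bool} (h : Incomparable a b)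
    (ha : 3 ≤ a.length) :
    ∃ c d : List Bool, c <+: a ∧ c.length = 3 ∧ d.length = 2 ∧ Incomparable c d ∧
      Incomparable d b := by
  obtain ⟨x, y, z, t, rfl⟩ : ∃ x y z t, a = x :: y :: z :: t := by
    match a, ha with
    | x :: y :: z :: t, _ => exact ⟨x, y, z, t, rfl⟩
  have key : ∃ p q : Bool, (p ≠ x ∨ q ≠ y) ∧ Incomparable [p, q] b := by
    match b, h with
    | [], h => exact absurd List.nil_prefix h.2
    | [r], h =>
      refine ⟨x, !y, by simp, ?_⟩
      have hr : r ≠ x := by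
        rintro rfl
        exact h.2 ⟨y :: z :: t, rfl⟩
      constructor <;> simp [List.cons_prefix_cons, hr]
    | r :: s :: b, h =>
      have : ∃ p q : Bool, (p ≠ x ∨ q ≠ y) ∧ (p ≠ r ∨ q ≠ s) := by
        clear * -
        decide +revert
      obtain ⟨p, q, h1, h2⟩ := this
      refine ⟨p, q, h1, ?_⟩
      have h3 : Incomparable [p, q] [r, s] :=
        incomparable_of_length_eq rfl (by simpa [imp_iff_not_or] using h2)
      exact (h3.symm.extend_left ⟨b, rfl⟩).symm
  obtain ⟨p, q, h1, h2⟩ := key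
  refine ⟨[x, y, z], [p, q], ⟨t, rfl⟩, rfl, rfl, ?_, h2⟩
  have h3 : Incomparable [x, y] [p, q] :=
    incomparable_of_length_eq rfl (by
      rcases h1 with h1 | h1 <;> simp [Ne.symm h1])
  exact h3.extend_left ⟨[z], rfl⟩

/-- Induction on the total length: conjugating by the swap of `c` and `d` replaces the prefix `c` of
`a` by the shorter `d`, and does not lengthen `b`. -/
theorem IsConeSwap.mem_closure_shortSwaps {a b : List Bool} {g : Equiv.Perm Cantor}
    (hab : Incomparable a b) (hg : IsConeSwap a b g) : g ∈ Subgroup.closure shortSwaps := by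
  induction hn : a.length + b.length using Nat.strong_induction_on generalizing a b g with
  | _ n ih =>
    have step : ∀ {a b : List Bool} {g : Equiv.Perm Cantor}, Incomparable a b →
        IsConeSwap a b g → a.length + b.length = n → 3 < a.length →
        g ∈ Subgroup.closure shortSwaps := by
      intro a b g hab hg hn ha
      obtain ⟨c, d, ⟨k, rfl⟩, hc, hd, hcd, hdb⟩ := hab.exists_shorter ha.le
      obtain ⟨s, hs⟩ := hcd.exists_isConeSwap
      have hsm : s ∈ Subgroup.closure shortSwaps :=
        Subgroup.subset_closure ⟨c, d, hcd, by omega, by omega, hs⟩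
      have h1 : ∀ v, s ((c ++ k) ++ₛ v) = (d ++ k) ++ₛ v := fun v => by
        rw [Stream'.append_append_stream, hs.1, Stream'.append_append_stream]
      have conj_mem : ∀ b', Incomparable (d ++ k) b' → (∀ v, s (b ++ₛ v) = b' ++ₛ v) →
          b'.length ≤ b.length → g ∈ Subgroup.closure shortSwaps := by
        intro b' hb' h2 hl
        have h3 := ih _ (by simp only [List.length_append] at hn ⊢; omega) hb'
          (hg.conj h1 h2) rfl
        have h4 := mul_mem (mul_mem (inv_mem hsm) h3) hsm
        simpa [mul_assoc] using h4
      -- Either the cone of `b` lies inside that of `c` and moves along with it, or it is disjoint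
      -- from the cones of both `c` and `d` and stays fixed.
      by_cases hcb : c <+: b
      · obtain ⟨m, rfl⟩ := hcb
        refine conj_mem (d ++ m) ?_ (fun v => ?_) (by simp only [List.length_append]; omega)
        · simpa only [Incomparable, List.prefix_append_right_inj] using hab
        · rw [Stream'.append_append_stream, hs.1, Stream'.append_append_stream]
      · refine conj_mem b (hdb.extend_left ⟨k, rfl⟩) (fun v => ?_) le_rfl
        refine hs.2.2 _ (Incomparable.not_mem_cone ⟨fun h => hab.2 (h.trans ⟨k, rfl⟩), hcb⟩
          (append_mem_cone b v)) (hdb.symm.not_mem_cone (append_mem_cone b v))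
    by_cases ha : 3 < a.length
    · exact step hab hg hn ha
    by_cases hb : 3 < b.length
    · exact step hab.symm hg.symm (by omega) hb
    exact Subgroup.subset_closure ⟨a, b, hab, by omega, by omega, hg⟩

/-- Take a longest word of `F`. The word of `F` covering its sibling is no longer than the sibling,
hence a prefix of it; a proper prefix would also be a prefix of the longest word, against
disjointness. -/
theorem IsCompleteAntichain.exists_siblings {F : Finset (List Bool)} (hF : IsCompleteAntichain F)
    (hnil : [] ∉ F) : ∃ w : List Bool, ∀ b : Bool, w ++ [b] ∈ F := by
  have hne : F.Nonempty := by
    obtain ⟨w, hw, -⟩ := hF (Stream'.const false)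
    exact ⟨w, hw.1⟩
  obtain ⟨m, hm, hmax⟩ := F.exists_max_image List.length hne
  rcases List.eq_nil_or_concat' m with rfl | ⟨w, b, rfl⟩
  · exact absurd hm hnil
  have hb : w ++ [!b] ∈ F := by
    obtain ⟨u, ⟨huF, hu⟩, -⟩ := hF ((w ++ [!b]) ++ₛ Stream'.const false)
    have hl : u.length ≤ (w ++ [!b]).length := by simpa using hmax u huF
    have hp : u <+: w ++ [!b] := by
      rcases prefix_or_prefix_of_mem_cone hu (append_mem_cone _ _) with h | h
      · exact h
      · exact (h.eq_of_length (le_antisymm h.length_le hl)) ▸ List.prefix_rfl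
    rcases List.prefix_concat_iff.1 hp with h | h
    · rwa [← h]
    · exfalso
      have h1 : u <+: w ++ [b] := h.trans ⟨[b], rfl⟩
      have h2 := (hF ((w ++ [b]) ++ₛ Stream'.const false)).unique
        ⟨huF, mem_cone_of_prefix h1 (append_mem_cone _ _)⟩ ⟨hm, append_mem_cone _ _⟩
      have h3 := h.length_le
      rw [h2] at h3
      simp at h3
  refine ⟨w, fun b' => ?_⟩
  rcases Bool.eq_or_eq_not b' b with rfl | rfl
  · exact hm
  · exact hb

/-- `T` is a table of prefix replacements that describes the permutation `f`. -/
def HasTable (f : Equiv.Perm Cantor) (T : Finset (List Bool × List Bool)) : Prop :=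
  (∀ p ∈ T, ∀ v, f (p.1 ++ₛ v) = p.2 ++ₛ v) ∧ ∀ x, ∃! p, p ∈ T ∧ x ∈ cone p.1

namespace HasTable

variable {f : Equiv.Perm Cantor} {T : Finset (List Bool × List Bool)}

theorem existsUnique_snd (h : HasTable f T) (y : Cantor) : ∃! p, p ∈ T ∧ y ∈ cone p.2 := by
  obtain ⟨x, rfl⟩ := f.surjective y
  obtain ⟨p, ⟨hp, v, rfl⟩, hu⟩ := h.2 x
  refine ⟨p, ⟨hp, v, h.1 p hp v⟩, ?_⟩
  rintro q ⟨hq, v', hv'⟩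
  refine hu q ⟨hq, v', f.injective ?_⟩
  rw [h.1 q hq, hv']

theorem isCompleteAntichain_fst (h : HasTable f T) :
    IsCompleteAntichain (T.image Prod.fst) := by
  intro x
  obtain ⟨p, ⟨hp, hx⟩, hu⟩ := h.2 x
  refine ⟨p.1, ⟨Finset.mem_image_of_mem _ hp, hx⟩, ?_⟩
  rintro w ⟨hw, hxw⟩
  obtain ⟨q, hq, rfl⟩ := Finset.mem_image.1 hw
  rw [hu q ⟨hq, hxw⟩]

theorem isCompleteAntichain_snd (h : HasTable f T) :
    IsCompleteAntichain (T.image Prod.snd) := by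
  intro x
  obtain ⟨p, ⟨hp, hx⟩, hu⟩ := h.existsUnique_snd x
  refine ⟨p.2, ⟨Finset.mem_image_of_mem _ hp, hx⟩, ?_⟩
  rintro w ⟨hw, hxw⟩
  obtain ⟨q, hq, rfl⟩ := Finset.mem_image.1 hw
  rw [hu q ⟨hq, hxw⟩]

theorem incomparable_snd (h : HasTable f T) {p q : List Bool × List Bool} (hp : p ∈ T)
    (hq : q ∈ T) (hpq : p ≠ q) : Incomparable p.2 q.2 := by
  constructor
  · intro hk
    exact hpq ((h.existsUnique_snd (q.2 ++ₛ Stream'.const false)).unique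
      ⟨hp, mem_cone_of_prefix hk (append_mem_cone _ _)⟩ ⟨hq, append_mem_cone _ _⟩)
  · intro hk
    exact hpq ((h.existsUnique_snd (p.2 ++ₛ Stream'.const false)).unique
      ⟨hp, append_mem_cone _ _⟩ ⟨hq, mem_cone_of_prefix hk (append_mem_cone _ _)⟩)

theorem exists_swap (h : HasTable f T) {p q : List Bool × List Bool} (hp : p ∈ T) (hq : q ∈ T) :
    ∃ s ∈ Subgroup.closure shortSwaps,
      HasTable (s * f) (T.image (Prod.map id (Equiv.swap p.2 q.2))) := by
  by_cases hpq : p = q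
  · subst hpq
    exact ⟨1, one_mem _, by simpa using h⟩
  have hi := h.incomparable_snd hp hq hpq
  obtain ⟨s, hs⟩ := hi.exists_isConeSwap
  refine ⟨s, hs.mem_closure_shortSwaps hi, ?_, fun x => ?_⟩
  · intro r' hr' v
    obtain ⟨r, hr, rfl⟩ := Finset.mem_image.1 hr'
    change s (f (r.1 ++ₛ v)) = Equiv.swap p.2 q.2 r.2 ++ₛ v
    rw [h.1 r hr]
    by_cases hrp : r = p
    · rw [hrp, Equiv.swap_apply_left, hs.1]
    by_cases hrq : r = q
    · rw [hrq, Equiv.swap_apply_right, hs.2.1]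
    have h1 := h.incomparable_snd hr hp hrp
    have h2 := h.incomparable_snd hr hq hrq
    rw [Equiv.swap_apply_of_ne_of_ne (fun e => h1.1 (by rw [e]))
      (fun e => h2.1 (by rw [e])), hs.2.2 _ (h1.not_mem_cone (append_mem_cone _ _))
      (h2.not_mem_cone (append_mem_cone _ _))]
  · obtain ⟨r, ⟨hr, hx⟩, hu⟩ := h.2 x
    refine ⟨Prod.map id (Equiv.swap p.2 q.2) r, ⟨Finset.mem_image_of_mem _ hr, hx⟩, ?_⟩
    rintro t' ⟨ht', hxt⟩
    obtain ⟨t, ht, rfl⟩ := Finset.mem_image.1 ht'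
    rw [hu t ⟨ht, hxt⟩]

/-- Swapping the current image of `u` with `z` creates the row `(u, z)`. The last clause ensures
that a second move does not undo the first. -/
theorem exists_move (h : HasTable f T) {u z : List Bool} (hu : u ∈ T.image Prod.fst)
    (hz : z ∈ T.image Prod.snd) :
    ∃ s ∈ Subgroup.closure shortSwaps, ∃ T', HasTable (s * f) T' ∧ T'.card ≤ T.card ∧
      T.image Prod.fst ⊆ T'.image Prod.fst ∧ T.image Prod.snd ⊆ T'.image Prod.snd ∧
      (u, z) ∈ T' ∧ ∀ r ∈ T, r.1 ≠ u → r.2 ≠ z → r ∈ T' := by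
  obtain ⟨⟨u, a⟩, hp, rfl⟩ := Finset.mem_image.1 hu
  obtain ⟨⟨c, z⟩, hq, rfl⟩ := Finset.mem_image.1 hz
  obtain ⟨s, hs, hT⟩ := h.exists_swap hp hq
  have hmem : ∀ r ∈ T, (r.1, Equiv.swap a z r.2) ∈
      T.image (Prod.map id (Equiv.swap a z)) := fun r hr =>
    Finset.mem_image_of_mem (Prod.map id (Equiv.swap a z)) hr
  refine ⟨s, hs, _, hT, Finset.card_image_le, ?_, ?_, ?_, ?_⟩
  · intro x hx
    obtain ⟨r, hr, rfl⟩ := Finset.mem_image.1 hx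
    exact Finset.mem_image.2 ⟨_, hmem r hr, rfl⟩
  · intro x hx
    obtain ⟨r, hr, rfl⟩ := Finset.mem_image.1 hx
    by_cases h1 : r.2 = a
    · rw [h1]
      simpa using Finset.mem_image_of_mem Prod.snd (hmem _ hq)
    by_cases h2 : r.2 = z
    · rw [h2]
      simpa using Finset.mem_image_of_mem Prod.snd (hmem _ hp)
    simpa [Equiv.swap_apply_of_ne_of_ne h1 h2] using
      Finset.mem_image_of_mem Prod.snd (hmem _ hr)
  · simpa using hmem _ hp
  · intro r hr h1 h2
    have h3 : r.2 ≠ a := fun e => by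
      have := h.incomparable_snd hr hp (fun e' => h1 (by rw [e']))
      exact this.1 (by rw [e])
    have := hmem r hr
    rwa [Equiv.swap_apply_of_ne_of_ne h3 h2] at this

theorem merge (h : HasTable f T) {w z : List Bool} (hT : ∀ b, (w ++ [b], z ++ [b]) ∈ T) :
    ∃ T', HasTable f T' ∧ T'.card < T.card := by
  let p : Bool → List Bool × List Bool := fun b => (w ++ [b], z ++ [b])
  have hpT : ∀ b, p b ∈ T := hT
  have hne : p true ≠ p false := by simp [p]
  have hcone : ∀ x, x ∈ cone w ↔ ∃ b, x ∈ cone (p b).1 := by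
    intro x
    constructor
    · rintro ⟨v, rfl⟩
      refine ⟨v.head, v.tail, ?_⟩
      rw [Stream'.append_append_stream, Stream'.append_stream_head_tail]
    · rintro ⟨b, hb⟩
      exact mem_cone_of_prefix ⟨[b], rfl⟩ hb
  refine ⟨insert (w, z) ((T.erase (p false)).erase (p true)), ⟨?_, fun x => ?_⟩, ?_⟩
  · intro q hq v
    rcases Finset.mem_insert.1 hq with rfl | hq
    · have := h.1 _ (hpT v.head) v.tail
      simpa only [p, Stream'.append_append_stream, Stream'.append_stream_head_tail] using this
    · exact h.1 q (Finset.mem_of_mem_erase (Finset.mem_of_mem_erase hq)) v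
  · by_cases hx : x ∈ cone w
    · refine ⟨(w, z), ⟨Finset.mem_insert_self _ _, hx⟩, ?_⟩
      rintro q ⟨hq, hxq⟩
      rcases Finset.mem_insert.1 hq with rfl | hq
      · rfl
      obtain ⟨b, hb⟩ := (hcone x).1 hx
      obtain ⟨hq1, hq⟩ := Finset.mem_erase.1 hq
      obtain ⟨hq2, hq⟩ := Finset.mem_erase.1 hq
      have : q = p b := (h.2 x).unique ⟨hq, hxq⟩ ⟨hpT b, hb⟩
      cases b
      · exact absurd this hq2
      · exact absurd this hq1
    · obtain ⟨r, ⟨hr, hxr⟩, hu⟩ := h.2 x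
      have hrp : ∀ b, r ≠ p b := by
        rintro b rfl
        exact hx ((hcone x).2 ⟨b, hxr⟩)
      refine ⟨r, ⟨Finset.mem_insert_of_mem (Finset.mem_erase.2 ⟨hrp _, Finset.mem_erase.2
        ⟨hrp _, hr⟩⟩), hxr⟩, ?_⟩
      rintro q ⟨hq, hxq⟩
      rcases Finset.mem_insert.1 hq with rfl | hq
      · exact absurd hxq hx
      · exact hu q ⟨Finset.mem_of_mem_erase (Finset.mem_of_mem_erase hq), hxq⟩
  · have h1 : (T.erase (p false)).card + 1 = T.card := Finset.card_erase_add_one (hpT _)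
    have h2 : ((T.erase (p false)).erase (p true)).card + 1 = (T.erase (p false)).card :=
      Finset.card_erase_add_one (Finset.mem_erase.2 ⟨hne, hpT _⟩)
    have h3 := Finset.card_insert_le (w, z) ((T.erase (p false)).erase (p true))
    omega

theorem eq_one_of_nil_fst (h : HasTable f T) (hT : [] ∈ T.image Prod.fst) : f = 1 := by
  obtain ⟨⟨a, b⟩, hp, rfl : a = []⟩ := Finset.mem_image.1 hT
  have h1 : ∀ v, f v = b ++ₛ v := h.1 _ hp
  have hb : b = [] := eq_nil_of_surjective_append fun x => ⟨f.symm x, by rw [← h1]; simp⟩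
  ext1 v
  rw [h1, hb]
  rfl

theorem eq_one_of_nil_snd (h : HasTable f T) (hT : [] ∈ T.image Prod.snd) : f = 1 := by
  obtain ⟨⟨a, b⟩, hp, rfl : b = []⟩ := Finset.mem_image.1 hT
  have h1 : ∀ v, f (a ++ₛ v) = v := h.1 _ hp
  have ha : a = [] :=
    eq_nil_of_surjective_append fun x => ⟨f x, f.injective (h1 (f x))⟩
  ext1 v
  rw [ha] at h1
  exact h1 v

/-- Induction on the number of rows: two moves send a sibling pair in the first column to a sibling
pair in the second, in order, after which the two rows merge into one. -/
theorem mem_closure_shortSwaps (h : HasTable f T) : f ∈ Subgroup.closure shortSwaps := by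
  induction hn : T.card using Nat.strong_induction_on generalizing f T with
  | _ n ih =>
    by_cases h1 : [] ∈ T.image Prod.fst
    · rw [h.eq_one_of_nil_fst h1]
      exact one_mem _
    by_cases h2 : [] ∈ T.image Prod.snd
    · rw [h.eq_one_of_nil_snd h2]
      exact one_mem _
    obtain ⟨w, hw⟩ := h.isCompleteAntichain_fst.exists_siblings h1
    obtain ⟨z, hz⟩ := h.isCompleteAntichain_snd.exists_siblings h2
    obtain ⟨s, hs, T₁, hT₁, hc₁, hf₁, hs₁, hm₁, -⟩ := h.exists_move (hw false) (hz false)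
    obtain ⟨r, hs', T₂, hT₂, hc₂, -, -, hm₂, hk₂⟩ :=
      hT₁.exists_move (hf₁ (hw true)) (hs₁ (hz true))
    have hk : (w ++ [false], z ++ [false]) ∈ T₂ := hk₂ _ hm₁ (by simp) (by simp)
    obtain ⟨T₃, hT₃, hc₃⟩ := hT₂.merge (w := w) (z := z) (by
      rintro (_ | _)
      · exact hk
      · exact hm₂)
    have h3 := ih T₃.card (by omega) hT₃ rfl
    rwa [Subgroup.mul_mem_cancel_left _ hs', Subgroup.mul_mem_cancel_left _ hs] at h3

end HasTable

theorem thompsonV_subset_closure_shortSwaps {f : Equiv.Perm Cantor} (hf : f ∈ thompsonV) :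
    f ∈ Subgroup.closure shortSwaps := by
  obtain ⟨F₁, F₂, h₁, -, φ, hφ⟩ := hf
  refine HasTable.mem_closure_shortSwaps
    (T := F₁.attach.image fun w : F₁ => ((w : List Bool), (φ w : List Bool))) ⟨?_, fun x => ?_⟩
  · intro p hp v
    obtain ⟨w, -, rfl⟩ := Finset.mem_image.1 hp
    exact hφ w v
  · obtain ⟨w, ⟨hw, hx⟩, hu⟩ := h₁ x
    refine ⟨(w, φ ⟨w, hw⟩), ⟨Finset.mem_image.2 ⟨⟨w, hw⟩, Finset.mem_attach _ _, rfl⟩, hx⟩, ?_⟩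
    rintro p ⟨hp, hxp⟩
    obtain ⟨⟨w', hw'⟩, -, rfl⟩ := Finset.mem_image.1 hp
    obtain rfl := hu w' ⟨hw', hxp⟩
    rfl

/-! ### Partial bijections as relations -/

namespace SymInvMonoid

variable {X : Type*}

/-- `s.Maps x y` means that the partial bijection `s` is defined at `x`, with value `y`. -/
def Maps (s : SymInvMonoid X) (x y : X) : Prop := y ∈ PEquiv.toFun s x

/-- The domain of a partial bijection. -/
def dom (s : SymInvMonoid X) : Set X := {x | ∃ y, s.Maps x y}

theorem ext_maps {s t : SymInvMonoid X} (h : ∀ x y, s.Maps x y ↔ t.Maps x y) : s = t :=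
  PEquiv.ext fun x => Option.ext fun y => h x y

theorem maps_mul {s t : SymInvMonoid X} {x z : X} :
    (s * t).Maps x z ↔ ∃ y, s.Maps x y ∧ t.Maps y z := PEquiv.mem_trans s t x z

theorem maps_inv {s : SymInvMonoid X} {x y : X} : s⁻¹.Maps x y ↔ s.Maps y x :=
  PEquiv.mem_iff_mem s

theorem Maps.right_unique {s : SymInvMonoid X} {x y z : X} (h : s.Maps x y) (h' : s.Maps x z) :
    y = z := Option.mem_unique h h'

theorem Maps.left_unique {s : SymInvMonoid X} {x y z : X} (h : s.Maps x z) (h' : s.Maps y z) :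
    x = y := (maps_inv.2 h).right_unique (maps_inv.2 h')

theorem maps_one {x y : X} : (1 : SymInvMonoid X).Maps x y ↔ x = y :=
  Option.some_inj

theorem maps_ofPerm {f : Equiv.Perm X} {x y : X} : (ofPerm f).Maps x y ↔ f x = y :=
  Option.some_inj

theorem maps_idOn {A : Set X} {x y : X} : (idOn A).Maps x y ↔ x ∈ A ∧ x = y := by
  classical
  change y ∈ PEquiv.ofSet A x ↔ _
  rw [PEquiv.mem_ofSet_iff]
  constructor
  · rintro ⟨rfl, h⟩
    exact ⟨h, rfl⟩
  · rintro ⟨h, rfl⟩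
    exact ⟨rfl, h⟩

theorem inv_mul_rev (s t : SymInvMonoid X) : (s * t)⁻¹ = t⁻¹ * s⁻¹ :=
  ext_maps fun x y => by simp only [maps_mul, maps_inv, and_comm]

theorem inv_inv' (s : SymInvMonoid X) : s⁻¹⁻¹ = s := PEquiv.symm_symm s

theorem inv_idOn (A : Set X) : (idOn A)⁻¹ = idOn A :=
  ext_maps fun x y => by
    simp only [maps_inv, maps_idOn]
    constructor <;> (rintro ⟨h, rfl⟩; exact ⟨h, rfl⟩)

theorem idOn_mul_idOn (A B : Set X) : idOn A * idOn B = idOn (A ∩ B) :=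
  ext_maps fun x y => by
    simp only [maps_mul, maps_idOn]
    constructor
    · rintro ⟨_, ⟨h, rfl⟩, h', rfl⟩
      exact ⟨⟨h, h'⟩, rfl⟩
    · rintro ⟨⟨h, h'⟩, rfl⟩
      exact ⟨x, ⟨h, rfl⟩, h', rfl⟩

theorem conj_idOn (f : Equiv.Perm X) (A : Set X) :
    ofPerm f * idOn A * (ofPerm f)⁻¹ = idOn (f ⁻¹' A) :=
  ext_maps fun x y => by
    simp only [maps_mul, maps_idOn, maps_inv, maps_ofPerm]
    constructor
    · rintro ⟨_, ⟨_, rfl, h, rfl⟩, h'⟩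
      exact ⟨h, (f.injective h').symm⟩
    · rintro ⟨h, rfl⟩
      exact ⟨f x, ⟨f x, rfl, h, rfl⟩, rfl⟩

theorem ofPerm_one : ofPerm (1 : Equiv.Perm X) = 1 :=
  ext_maps fun x y => by rw [maps_ofPerm, maps_one]; rfl

theorem ofPerm_mul (f g : Equiv.Perm X) : ofPerm (f * g) = ofPerm g * ofPerm f :=
  ext_maps fun x y => by simp [maps_mul, maps_ofPerm]

theorem ofPerm_inv (f : Equiv.Perm X) : ofPerm f⁻¹ = (ofPerm f)⁻¹ :=
  ext_maps fun x y => by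
    rw [maps_inv, maps_ofPerm, maps_ofPerm]
    exact f.symm_apply_eq.trans eq_comm

theorem eq_of_maps_of_isIdempotentElem {s : SymInvMonoid X} (hs : IsIdempotentElem s) {x y : X}
    (h : s.Maps x y) : x = y := by
  have h' := h
  rw [← hs, maps_mul] at h'
  obtain ⟨z, h1, h2⟩ := h'
  rw [← h.right_unique h1] at h2
  exact h.left_unique h2

theorem isIdempotentElem_of_forall_not_maps {s : SymInvMonoid X} (hs : ∀ x y, ¬ s.Maps x y) :
    IsIdempotentElem s :=
  ext_maps fun x y => by
    rw [maps_mul]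
    exact ⟨fun ⟨z, h, _⟩ => absurd h (hs x z), fun h => absurd h (hs x y)⟩

/-- The factor `x` carries the domain of the product injectively into that of `s`. Thus rank is an
invariant of `𝒥`-classes. -/
theorem encard_dom_le_of_principal (x s y : SymInvMonoid X) :
    (x * s * y).dom.encard ≤ s.dom.encard := by
  have h : ∀ a ∈ (x * s * y).dom, ∃ b, x.Maps a b ∧ b ∈ s.dom := by
    rintro a ⟨d, hd⟩
    obtain ⟨c, hc, -⟩ := maps_mul.1 hd
    obtain ⟨b, hb, hbc⟩ := maps_mul.1 hc
    exact ⟨b, hb, c, hbc⟩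
  choose! g hg hgs using h
  refine Set.encard_le_encard_of_injOn hgs fun a ha a' ha' e => ?_
  have h1 := hg a ha
  rw [e] at h1
  exact h1.left_unique (hg a' ha')

theorem dom_idOn (A : Set X) : (idOn A).dom = A := by
  ext x
  exact ⟨fun ⟨_, h⟩ => (maps_idOn.1 h).1, fun h => ⟨x, maps_idOn.2 ⟨h, rfl⟩⟩⟩

end SymInvMonoid

open SymInvMonoid

theorem InverseSubmonoid.closure_induction {M : Type*} [InverseMonoid M] {A : Set M}
    {p : M → Prop} (hA : ∀ x ∈ A, p x) (one : p 1) (mul : ∀ x y, p x → p y → p (x * y))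
    (inv : ∀ x, p x → p x⁻¹) {x : M} (hx : x ∈ (InverseSubmonoid.closure A).toSubmonoid) : p x :=
  hx { carrier := {x | p x}, mul_mem' := fun {x y} => mul x y, one_mem' := one, inv_mem' := inv } hA

theorem InverseSubmonoid.subset_closure {M : Type*} [InverseMonoid M] {A : Set M} {x : M}
    (hx : x ∈ A) : x ∈ (InverseSubmonoid.closure A).toSubmonoid := fun _ hN => hN hx

/-! ### Finite generation -/

theorem ofPerm_mem_of_shortSwaps (N : InverseSubmonoid (SymInvMonoid Cantor))
    (hN : ∀ g ∈ shortSwaps, ofPerm g ∈ N.toSubmonoid) {f : Equiv.Perm Cantor}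
    (hf : f ∈ thompsonV) : ofPerm f ∈ N.toSubmonoid := by
  have hf' := thompsonV_subset_closure_shortSwaps hf
  clear hf
  induction hf' using Subgroup.closure_induction with
  | mem g hg => exact hN g hg
  | one => exact ofPerm_one ▸ N.one_mem
  -- The factors appear reversed because permutations compose right to left and partial maps left to
  -- right.
  | mul f g _ _ hf hg => exact ofPerm_mul f g ▸ N.mul_mem hg hf
  | inv f _ hf => exact ofPerm_inv f ▸ N.inv_mem' _ hf

theorem ofPerm_mem_thompsonInverseMonoid {f : Equiv.Perm Cantor} (hf : f ∈ thompsonV) :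
    ofPerm f ∈ thompsonInverseMonoid.toSubmonoid :=
  InverseSubmonoid.subset_closure (Or.inl ⟨f, hf, rfl⟩)

theorem idOn_cone_true_mem_thompsonInverseMonoid :
    idOn (cone [true]) ∈ thompsonInverseMonoid.toSubmonoid :=
  InverseSubmonoid.subset_closure (Or.inr (Or.inl rfl))

theorem idOn_onesThenZeros_mem_thompsonInverseMonoid :
    idOn onesThenZeros ∈ thompsonInverseMonoid.toSubmonoid :=
  InverseSubmonoid.subset_closure (Or.inr (Or.inr rfl))

theorem finitelyGenerated_thompsonInverseMonoid :
    InverseMonoid.FinitelyGenerated thompsonInverseMonoid.toSubmonoid := by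
  let A : Set (SymInvMonoid Cantor) :=
    ofPerm '' shortSwaps ∪ {idOn (cone [true]), idOn onesThenZeros}
  have hA : A.Finite := (finite_shortSwaps.image _).union (Set.toFinite _)
  refine ⟨Subtype.val ⁻¹' A, hA.preimage Subtype.val_injective.injOn, fun x K hK => ?_⟩
  -- `K` lives inside the submonoid; its image in the ambient monoid is what the definition of the
  -- closure can be tested against.
  let K' : InverseSubmonoid (SymInvMonoid Cantor) :=
    { carrier := {y | ∃ h : y ∈ thompsonInverseMonoid.toSubmonoid, ⟨y, h⟩ ∈ K.carrier}
      mul_mem' := fun ⟨h, hk⟩ ⟨h', hk'⟩ => ⟨mul_mem h h', K.mul_mem' hk hk'⟩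
      one_mem' := ⟨one_mem _, K.one_mem'⟩
      inv_mem' := fun _ ⟨h, hk⟩ => ⟨thompsonInverseMonoid.inv_mem' _ h, K.inv_mem' _ hk⟩ }
  obtain ⟨_, h⟩ : (x : SymInvMonoid Cantor) ∈ K'.carrier := by
    refine x.2 K' ?_
    rintro y (⟨f, hf, rfl⟩ | hy)
    · exact ofPerm_mem_of_shortSwaps K' (fun g hg =>
        ⟨ofPerm_mem_thompsonInverseMonoid (shortSwaps_subset_thompsonV hg),
          hK (Or.inl ⟨g, hg, rfl⟩)⟩) hf
    · exact ⟨InverseSubmonoid.subset_closure (Or.inr hy), hK (Or.inr hy)⟩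
  exact h

/-! ### Infinitely many `𝒥`-classes -/

/-- The sequence `1ⁿ0^ω`. -/
def onesZeros (n : ℕ) : Cantor := List.replicate n true ++ₛ Stream'.const false

theorem get_onesZeros (n i : ℕ) : (onesZeros n).get i = decide (i < n) := by
  by_cases h : i < n
  · rw [onesZeros, Stream'.get_append_left _ _ _ (by simpa using h)]
    simp [h]
  · obtain ⟨k, rfl⟩ := Nat.exists_eq_add_of_le (not_lt.1 h)
    have := Stream'.get_append_right k (List.replicate n true) (Stream'.const false)
    rw [List.length_replicate] at this
    rw [onesZeros, this]
    simp

theorem onesZeros_injective : Function.Injective onesZeros := by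
  have key : ∀ m n, onesZeros m = onesZeros n → m ≤ n := fun m n h => by
    have h1 := congrArg (fun x => Stream'.get x n) h
    simpa [get_onesZeros] using h1
  exact fun m n h => le_antisymm (key m n h) (key n m h.symm)

theorem replicate_append_onesZeros (n k : ℕ) :
    List.replicate n true ++ₛ onesZeros k = onesZeros (n + k) := by
  rw [onesZeros, onesZeros, ← Stream'.append_append_stream, List.replicate_append_replicate]

theorem onesZeros_zero_eq : onesZeros 0 = [false] ++ₛ onesZeros 0 :=
  Stream'.const_eq false

/-- The swap exchanges `0^ω` with `1ⁿ0^ω` and fixes `1ᵏ0^ω` for `0 < k < n`. For `k > n` it sends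
`1ᵏ0^ω` to `01ᵏ⁻ⁿ0^ω`, which leaves the set. -/
theorem IsConeSwap.preimage_inter_onesThenZeros {n : ℕ} {g : Equiv.Perm Cantor}
    (hn : 0 < n) (hg : IsConeSwap [false] (List.replicate n true) g) :
    onesThenZeros ∩ g ⁻¹' onesThenZeros = onesZeros '' Set.Iic n := by
  have hmem : ∀ x, x ∈ onesThenZeros ↔ ∃ k, x = onesZeros k := fun x => Iff.rfl
  have h0 : g (onesZeros 0) = onesZeros n := by
    rw [onesZeros_zero_eq, hg.1, replicate_append_onesZeros, add_zero]
  have hle : ∀ k, g (onesZeros (n + k)) = [false] ++ₛ onesZeros k := fun k => by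
    rw [← replicate_append_onesZeros, hg.2.1]
  ext x
  constructor
  · rintro ⟨⟨k, rfl⟩, hk⟩
    refine ⟨k, ?_, rfl⟩
    by_contra hkn
    obtain ⟨j, rfl⟩ := Nat.exists_eq_add_of_le (le_of_not_ge hkn)
    obtain ⟨m, hm⟩ := (hmem _).1 hk
    change g (onesZeros (n + j)) = _ at hm
    rw [hle] at hm
    -- The letter at position 0 forces `m = 0`, and then the letter at position 1 forces `j = 0`.
    have h1 := congrArg (fun x => Stream'.get x 0) hm
    have h2 := congrArg (fun x => Stream'.get x 1) hm
    have h3 : Stream'.get ([false] ++ₛ onesZeros j) 0 = false := rfl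
    have h4 : Stream'.get ([false] ++ₛ onesZeros j) 1 = (onesZeros j).get 0 := rfl
    simp only [h3, h4, get_onesZeros] at h1 h2
    simp at h1 h2 hkn
    omega
  · rintro ⟨k, hk, rfl⟩
    refine ⟨⟨k, rfl⟩, (hmem _).2 ?_⟩
    rcases Nat.eq_zero_or_pos k with rfl | hk0
    · exact ⟨n, h0⟩
    rcases (Set.mem_Iic.1 hk).lt_or_eq with hlt | rfl
    · refine ⟨k, hg.2.2 _ ?_ ?_⟩
      · rintro ⟨v, hv⟩
        have h1 := congrArg (fun x => Stream'.get x 0) hv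
        have h3 : Stream'.get ([false] ++ₛ v) 0 = false := rfl
        simp only [h3, get_onesZeros] at h1
        simp at h1
        omega
      · rintro ⟨v, hv⟩
        have h1 := congrArg (fun x => Stream'.get x k) hv
        simp only [get_onesZeros] at h1
        rw [Stream'.get_append_left _ _ _ (by simpa using hlt)] at h1
        simp at h1
    · refine ⟨0, ?_⟩
      have := hle 0
      rw [add_zero] at this
      rw [this, ← onesZeros_zero_eq]

theorem idOn_onesZeros_mem_thompsonInverseMonoid {n : ℕ} (hn : 0 < n) :
    idOn (onesZeros '' Set.Iic n) ∈ thompsonInverseMonoid.toSubmonoid := by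
  have hi : Incomparable [false] (List.replicate n true) := by
    obtain ⟨m, rfl⟩ := Nat.exists_eq_add_of_le' hn
    constructor <;> simp [List.replicate_succ, List.cons_prefix_cons]
  obtain ⟨g, hg⟩ := hi.exists_isConeSwap
  rw [← hg.preimage_inter_onesThenZeros hn, ← idOn_mul_idOn, ← conj_idOn]
  have hgm := ofPerm_mem_thompsonInverseMonoid (hg.mem_thompsonV hi)
  have hf := idOn_onesThenZeros_mem_thompsonInverseMonoid
  exact mul_mem hf (mul_mem (mul_mem hgm hf) (thompsonInverseMonoid.inv_mem' _ hgm))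

theorem infinite_jClasses_thompsonInverseMonoid :
    Infinite (JClasses thompsonInverseMonoid.toSubmonoid) := by
  let e : ℕ → thompsonInverseMonoid.toSubmonoid := fun n =>
    ⟨idOn (onesZeros '' Set.Iic (n + 1)),
      idOn_onesZeros_mem_thompsonInverseMonoid n.succ_pos⟩
  have hcard : ∀ n, (e n : SymInvMonoid Cantor).dom.encard = (n + 2 : ℕ) := fun n => by
    rw [dom_idOn, onesZeros_injective.encard_image, ← Finset.coe_Iic,
      Set.encard_coe_eq_coe_finsetCard, Nat.card_Iic]
  have key : ∀ m n, principalIdeal (e m) = principalIdeal (e n) → m ≤ n := fun m n h => by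
    have hm : e m ∈ principalIdeal (e m) := ⟨1, 1, by simp⟩
    rw [h] at hm
    obtain ⟨x, y, hxy⟩ := hm
    have h1 := encard_dom_le_of_principal (x : SymInvMonoid Cantor) (e n) y
    have h2 : (e m : SymInvMonoid Cantor) = x * e n * y := congrArg Subtype.val hxy
    rw [← h2, hcard, hcard, Nat.cast_le] at h1
    omega
  refine Infinite.of_injective (fun n => (Quotient.mk _ (e n) : JClasses _)) fun m n h => ?_
  have h' : principalIdeal (e m) = principalIdeal (e n) := Quotient.exact h
  exact le_antisymm (key m n h') (key n m h'.symm)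

/-! ### Eventually zero sequences -/

/-- The sequences that end in `0^ω`. -/
def eventuallyZero : Set Cantor := {x | ∃ u : List Bool, x = u ++ₛ Stream'.const false}

theorem append_mem_eventuallyZero {u : List Bool} {v : Cantor} :
    u ++ₛ v ∈ eventuallyZero ↔ v ∈ eventuallyZero := by
  constructor
  · rintro ⟨w, h⟩
    rcases append_stream_eq_append_stream h with ⟨k, -, hk⟩ | ⟨k, -, hk⟩
    · exact ⟨k, hk⟩
    · refine ⟨[], ?_⟩
      rw [Stream'.nil_append_stream, ← Stream'.drop_append_stream k v, ← hk, Stream'.drop_const]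
  · rintro ⟨w, rfl⟩
    exact ⟨u ++ w, by simp⟩

theorem exists_common_prefix {u w : List Bool} {x : Cantor} (hu : x ∈ cone u)
    (hw : x ∈ cone w) : ∃ k l, u ++ k = w ++ l ∧ x ∈ cone (u ++ k) := by
  rcases prefix_or_prefix_of_mem_cone hu hw with ⟨k, rfl⟩ | ⟨k, rfl⟩
  · exact ⟨k, [], by simp, hw⟩
  · exact ⟨[], k, by simp, by simpa using hu⟩

theorem get_append_congr (w : List Bool) {v v' : Cantor} {n : ℕ} (h : v.take n = v'.take n)
    {i : ℕ} (hi : i < n) : (w ++ₛ v).get i = (w ++ₛ v').get i := by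
  rcases lt_or_ge i w.length with hw | hw
  · rw [Stream'.get_append_left _ _ _ hw, Stream'.get_append_left _ _ _ hw]
  · obtain ⟨j, rfl⟩ := Nat.exists_eq_add_of_le hw
    rw [Stream'.get_append_right, Stream'.get_append_right]
    have h1 := congrArg (fun l => l[j]?) h
    simpa [Stream'.getElem?_take (show j < n by omega)] using h1

/-- Eventually zero sequences are dense, so they detect equality of prefix maps. -/
theorem append_eq_append_of_eventuallyZero {u w : List Bool}
    (h : ∀ v ∈ eventuallyZero, u ++ₛ v = w ++ₛ v) (v : Cantor) : u ++ₛ v = w ++ₛ v := by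
  refine Stream'.ext fun i => ?_
  -- Letter `i` of a prefixed sequence depends only on the first `i + 1` letters of the tail, so the
  -- tail may be truncated to zeros.
  let v' : Cantor := v.take (i + 1) ++ₛ Stream'.const false
  have hv : v.take (i + 1) = v'.take (i + 1) := by
    rw [Stream'.take_append_of_le_length _ _ _ (by rw [Stream'.length_take])]
    simp [Stream'.take_take]
  rw [get_append_congr u hv i.lt_succ_self, get_append_congr w hv i.lt_succ_self,
    h v' ⟨_, rfl⟩]

/-! ### The two types of elements -/

/-- `s` is, around each point of its domain, a prefix replacement map. -/
def IsPrefixLocal (s : SymInvMonoid Cantor) : Prop :=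
  ∀ x y, s.Maps x y → ∃ u w v, x = u ++ₛ v ∧ y = w ++ₛ v ∧ ∀ v', s.Maps (u ++ₛ v') (w ++ₛ v')

/-- `A` is closed: each point outside of `A` has a cone that misses `A`. -/
def IsConeClosed (A : Set Cantor) : Prop :=
  ∀ x ∉ A, ∃ u, x ∈ cone u ∧ ∀ v, u ++ₛ v ∉ A

/-- `A` consists of eventually zero sequences and is nowhere dense. -/
def IsThin (A : Set Cantor) : Prop :=
  A ⊆ eventuallyZero ∧ ∀ u, ∃ k, ∀ v, (u ++ k) ++ₛ v ∉ A

/-- A prefix replacement map between clopen sets. -/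
structure IsClopenType (s : SymInvMonoid Cantor) : Prop where
  isPrefixLocal : IsPrefixLocal s
  dom_closed : IsConeClosed s.dom
  ran_closed : IsConeClosed s⁻¹.dom

/-- A bijection between thin sets. -/
def IsThinType (s : SymInvMonoid Cantor) : Prop := IsThin s.dom ∧ IsThin s⁻¹.dom

theorem IsPrefixLocal.inv {s : SymInvMonoid Cantor} (hs : IsPrefixLocal s) :
    IsPrefixLocal s⁻¹ := by
  intro x y h
  obtain ⟨u, w, v, rfl, rfl, huw⟩ := hs y x (maps_inv.1 h)
  exact ⟨w, u, v, rfl, rfl, fun v' => maps_inv.2 (huw v')⟩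

theorem IsClopenType.inv {s : SymInvMonoid Cantor} (hs : IsClopenType s) : IsClopenType s⁻¹ :=
  ⟨hs.isPrefixLocal.inv, hs.ran_closed, by rw [inv_inv']; exact hs.dom_closed⟩

theorem IsThinType.inv {s : SymInvMonoid Cantor} (hs : IsThinType s) : IsThinType s⁻¹ :=
  ⟨hs.2, by rw [inv_inv']; exact hs.1⟩

theorem IsPrefixLocal.mem_eventuallyZero {s : SymInvMonoid Cantor} (hs : IsPrefixLocal s)
    {x y : Cantor} (h : s.Maps x y) (hy : y ∈ eventuallyZero) : x ∈ eventuallyZero := by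
  obtain ⟨u, w, v, rfl, rfl, -⟩ := hs x y h
  exact append_mem_eventuallyZero.2 (append_mem_eventuallyZero.1 hy)

/-- The neighbourhood on which `s` replaces a prefix can be shrunk into any prescribed cone around
the point. -/
theorem IsPrefixLocal.exists_in_cone {s : SymInvMonoid Cantor} (hs : IsPrefixLocal s)
    {x y : Cantor} (h : s.Maps x y) {p : List Bool} (hp : x ∈ cone p) :
    ∃ k w v, x = (p ++ k) ++ₛ v ∧ y = w ++ₛ v ∧
      ∀ v', s.Maps ((p ++ k) ++ₛ v') (w ++ₛ v') := by
  obtain ⟨u, w, v, rfl, rfl, huw⟩ := hs x y h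
  obtain ⟨k, l, e, z, hz⟩ := exists_common_prefix hp (append_mem_cone u v)
  refine ⟨k, w ++ l, z, hz, ?_, fun v' => ?_⟩
  · rw [e, Stream'.append_append_stream, Stream'.append_right_inj] at hz
    rw [Stream'.append_append_stream, hz]
  · rw [e, Stream'.append_append_stream, Stream'.append_append_stream]
    exact huw _

theorem IsPrefixLocal.mul {s t : SymInvMonoid Cantor} (hs : IsPrefixLocal s)
    (ht : IsPrefixLocal t) : IsPrefixLocal (s * t) := by
  intro x z h
  obtain ⟨y, hxy, hyz⟩ := maps_mul.1 h
  obtain ⟨u, w, v, rfl, rfl, huw⟩ := hs x y hxy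
  obtain ⟨k, q, v', e, rfl, hq⟩ := ht.exists_in_cone hyz (append_mem_cone w v)
  rw [Stream'.append_append_stream, Stream'.append_right_inj] at e
  subst e
  refine ⟨u ++ k, q, v', by simp, rfl, fun v'' => maps_mul.2 ⟨(w ++ k) ++ₛ v'', ?_, hq v''⟩⟩
  rw [Stream'.append_append_stream, Stream'.append_append_stream]
  exact huw _

theorem IsConeClosed.dom_mul {s t : SymInvMonoid Cantor} (hs : IsPrefixLocal s)
    (hsd : IsConeClosed s.dom) (htd : IsConeClosed t.dom) : IsConeClosed (s * t).dom := by
  intro x hx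
  by_cases hxs : x ∈ s.dom
  · obtain ⟨y, hxy⟩ := hxs
    have hy : y ∉ t.dom := fun ⟨z, hz⟩ => hx ⟨z, maps_mul.2 ⟨y, hxy, hz⟩⟩
    obtain ⟨q, hq, hqt⟩ := htd y hy
    -- Continuity of `s` at `x`, read through the inverse: a cone around `x` is mapped into the cone
    -- of `q`, which misses the domain of `t`.
    obtain ⟨k, u, v, rfl, rfl, huw⟩ := hs.inv.exists_in_cone (maps_inv.2 hxy) hq
    refine ⟨u, append_mem_cone _ _, ?_⟩
    rintro v' ⟨z, hz⟩
    obtain ⟨y', h1, h2⟩ := maps_mul.1 hz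
    have h3 := h1.right_unique (maps_inv.1 (huw v'))
    subst h3
    exact hqt (k ++ₛ v') ⟨z, by rwa [Stream'.append_append_stream] at h2⟩
  · obtain ⟨u, hu, hus⟩ := hsd x hxs
    refine ⟨u, hu, ?_⟩
    rintro v ⟨z, hz⟩
    obtain ⟨y, hy, -⟩ := maps_mul.1 hz
    exact hus v ⟨y, hy⟩

theorem IsClopenType.mul {s t : SymInvMonoid Cantor} (hs : IsClopenType s)
    (ht : IsClopenType t) : IsClopenType (s * t) := by
  refine ⟨hs.isPrefixLocal.mul ht.isPrefixLocal,
    hs.dom_closed.dom_mul hs.isPrefixLocal ht.dom_closed, ?_⟩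
  rw [inv_mul_rev]
  exact ht.ran_closed.dom_mul ht.isPrefixLocal.inv hs.ran_closed

theorem IsThin.mono {A B : Set Cantor} (hB : IsThin B) (h : A ⊆ B) : IsThin A :=
  ⟨h.trans hB.1, fun u => (hB.2 u).imp fun _ hk v hv => hk v (h hv)⟩

theorem IsThin.dom_mul_right {s : SymInvMonoid Cantor} (hs : IsThin s.dom)
    (t : SymInvMonoid Cantor) : IsThin (s * t).dom :=
  hs.mono fun _ ⟨_, hz⟩ => (maps_mul.1 hz).imp fun _ h => h.1

/-- Prefix replacement preserves eventual zeros in both directions. For nowhere density, a cone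
either has a subcone missing the closed domain of `s`, or a subcone that `s` maps onto a cone, from
which a hole of the domain of `t` is pulled back. -/
theorem IsThin.dom_mul_left {s t : SymInvMonoid Cantor} (ht : IsThin t.dom)
    (hs : IsClopenType s) : IsThin (s * t).dom := by
  refine ⟨?_, fun u => ?_⟩
  · rintro x ⟨z, hz⟩
    obtain ⟨y, hy, hyz⟩ := maps_mul.1 hz
    exact hs.isPrefixLocal.mem_eventuallyZero hy (ht.1 ⟨z, hyz⟩)
  -- Any point of the cone of `u` would do as a test point.
  · by_cases hx : u ++ₛ Stream'.const false ∈ s.dom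
    · obtain ⟨y, hxy⟩ := hx
      obtain ⟨k, w, v, -, -, hw⟩ :=
        hs.isPrefixLocal.exists_in_cone hxy (append_mem_cone u _)
      obtain ⟨l, hl⟩ := ht.2 w
      refine ⟨k ++ l, ?_⟩
      rintro v' ⟨z, hz⟩
      obtain ⟨y', h1, h2⟩ := maps_mul.1 hz
      rw [← List.append_assoc, Stream'.append_append_stream] at h1
      have h3 := h1.right_unique (hw _)
      subst h3
      exact hl v' ⟨z, by rwa [Stream'.append_append_stream]⟩
    · obtain ⟨p, hp, hps⟩ := hs.dom_closed _ hx
      obtain ⟨k, l, e, -⟩ := exists_common_prefix (append_mem_cone u _) hp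
      refine ⟨k, ?_⟩
      rintro v' ⟨z, hz⟩
      obtain ⟨y', h1, -⟩ := maps_mul.1 hz
      rw [e, Stream'.append_append_stream] at h1
      exact hps _ ⟨y', h1⟩

theorem isClopenType_or_isThinType_mul {s t : SymInvMonoid Cantor}
    (hs : IsClopenType s ∨ IsThinType s) (ht : IsClopenType t ∨ IsThinType t) :
    IsClopenType (s * t) ∨ IsThinType (s * t) := by
  rcases hs with hs | hs <;> rcases ht with ht | ht
  · exact Or.inl (hs.mul ht)
  · refine Or.inr ⟨ht.1.dom_mul_left hs, ?_⟩
    rw [inv_mul_rev]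
    exact ht.2.dom_mul_right _
  · refine Or.inr ⟨hs.1.dom_mul_right _, ?_⟩
    rw [inv_mul_rev]
    exact hs.2.dom_mul_left ht.inv
  · refine Or.inr ⟨hs.1.dom_mul_right _, ?_⟩
    rw [inv_mul_rev]
    exact ht.2.dom_mul_right _

theorem isConeClosed_univ : IsConeClosed Set.univ := fun x hx => absurd (Set.mem_univ x) hx

theorem isClopenType_ofPerm {f : Equiv.Perm Cantor} (hf : f ∈ thompsonV) :
    IsClopenType (ofPerm f) := by
  have hd : ∀ g : Equiv.Perm Cantor, (ofPerm g).dom = Set.univ := fun g =>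
    Set.eq_univ_of_forall fun x => ⟨g x, maps_ofPerm.2 rfl⟩
  refine ⟨?_, by rw [hd]; exact isConeClosed_univ, by
    rw [← ofPerm_inv, hd]; exact isConeClosed_univ⟩
  intro x y h
  obtain rfl := maps_ofPerm.1 h
  obtain ⟨F₁, F₂, h₁, -, φ, hφ⟩ := hf
  obtain ⟨w, ⟨hw, v, rfl⟩, -⟩ := h₁ x
  exact ⟨w, φ ⟨w, hw⟩, v, rfl, hφ ⟨w, hw⟩ v, fun v' => maps_ofPerm.2 (hφ ⟨w, hw⟩ v')⟩

theorem isClopenType_idOn_cone_true : IsClopenType (idOn (cone [true])) := by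
  have hc : IsConeClosed (cone [true]) := by
    intro x hx
    refine ⟨[false], ⟨x.tail, ?_⟩, fun v => ?_⟩
    · have hh : x.head = false := by
        by_contra h
        rw [Bool.not_eq_false] at h
        exact hx ⟨x.tail, by rw [← h, Stream'.append_stream_head_tail]⟩
      rw [← hh, Stream'.append_stream_head_tail]
    · have hi : Incomparable [false] [true] := incomparable_of_length_eq rfl (by simp)
      exact hi.not_mem_cone (append_mem_cone [false] v)
  refine ⟨?_, by rwa [dom_idOn], by rwa [inv_idOn, dom_idOn]⟩
  intro x y h
  obtain ⟨⟨v, rfl⟩, rfl⟩ := maps_idOn.1 h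
  exact ⟨[true], [true], v, rfl, rfl, fun v' => maps_idOn.2 ⟨append_mem_cone _ _, rfl⟩⟩

theorem isThin_onesThenZeros : IsThin onesThenZeros := by
  -- No sequence `1ⁿ0^ω` has a 0 immediately followed by a 1.
  refine ⟨fun x ⟨n, hn⟩ => ⟨_, hn⟩, fun u => ⟨[false, true], ?_⟩⟩
  rintro v ⟨n, hn : _ = onesZeros n⟩
  have h0 : ((u ++ [false, true]) ++ₛ v).get u.length = false := by
    rw [Stream'.append_append_stream, Stream'.get_append_length]
    rfl
  have h1 : ((u ++ [false, true]) ++ₛ v).get (u.length + 1) = true := by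
    rw [Stream'.append_append_stream, Stream'.get_append_right]
    rfl
  rw [hn, get_onesZeros] at h0 h1
  simp at h0 h1
  omega

theorem isClopenType_or_isThinType {s : SymInvMonoid Cantor}
    (hs : s ∈ thompsonInverseMonoid.toSubmonoid) : IsClopenType s ∨ IsThinType s := by
  refine InverseSubmonoid.closure_induction (p := fun s => IsClopenType s ∨ IsThinType s) ?_ ?_
    (fun s t => isClopenType_or_isThinType_mul)
    (fun s hs => hs.imp IsClopenType.inv IsThinType.inv) hs
  · rintro _ (⟨f, hf, rfl⟩ | rfl | rfl)
    · exact Or.inl (isClopenType_ofPerm hf)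
    · exact Or.inl isClopenType_idOn_cone_true
    · refine Or.inr ⟨?_, ?_⟩
      · rw [dom_idOn]
        exact isThin_onesThenZeros
      · rw [inv_idOn, dom_idOn]
        exact isThin_onesThenZeros
  · have hd : (1 : SymInvMonoid Cantor).dom = Set.univ :=
      Set.eq_univ_of_forall fun x => ⟨x, maps_one.2 rfl⟩
    have hi : (1 : SymInvMonoid Cantor)⁻¹ = 1 :=
      ext_maps fun x y => by rw [maps_inv, maps_one, maps_one, eq_comm]
    refine Or.inl ⟨fun x y h => ?_, by rw [hd]; exact isConeClosed_univ,
      by rw [hi, hd]; exact isConeClosed_univ⟩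
    obtain rfl := maps_one.1 h
    exact ⟨[], [], x, rfl, rfl, fun v' => maps_one.2 rfl⟩

/-- A thin `s` relates only eventually zero points. A clopen `s` has a whole cone in its domain
around `x`; the eventually zero points there rule out a thin `t`, and also a cone around `x` missing
the domain of `t`. What remains is two prefix replacements on a common cone, equal by density. -/
theorem maps_of_maps_on_eventuallyZero {s t : SymInvMonoid Cantor}
    (hs : IsClopenType s ∨ IsThinType s) (ht : IsClopenType t ∨ IsThinType t)
    (h : ∀ x ∈ eventuallyZero, ∀ y ∈ eventuallyZero, s.Maps x y → t.Maps x y)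
    {x y : Cantor} (hxy : s.Maps x y) : t.Maps x y := by
  rcases hs with hs | hs
  · have h' : ∀ u w, (∀ v, s.Maps (u ++ₛ v) (w ++ₛ v)) →
        ∀ v ∈ eventuallyZero, t.Maps (u ++ₛ v) (w ++ₛ v) := fun u w huw v hv =>
      h _ (append_mem_eventuallyZero.2 hv) _ (append_mem_eventuallyZero.2 hv) (huw v)
    have hz : Stream'.const false ∈ eventuallyZero := ⟨[], rfl⟩
    rcases ht with ht | ht
    · by_cases hx : x ∈ t.dom
      · obtain ⟨y', hxy'⟩ := hx
        obtain ⟨u, q, v, rfl, rfl, hq⟩ := ht.isPrefixLocal x y' hxy'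
        obtain ⟨k, w, v', hv', rfl, hw⟩ :=
          hs.isPrefixLocal.exists_in_cone hxy (append_mem_cone u v)
        rw [Stream'.append_append_stream, Stream'.append_right_inj] at hv'
        subst hv'
        have hq' : ∀ z, t.Maps ((u ++ k) ++ₛ z) ((q ++ k) ++ₛ z) := fun z => by
          rw [Stream'.append_append_stream, Stream'.append_append_stream]
          exact hq _
        have := append_eq_append_of_eventuallyZero
          (fun z hz => (h' _ _ hw z hz).right_unique (hq' z)) v'
        rwa [this, Stream'.append_append_stream]
      · obtain ⟨p, hp, hpt⟩ := ht.dom_closed x hx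
        obtain ⟨k, w, v, rfl, rfl, hw⟩ := hs.isPrefixLocal.exists_in_cone hxy hp
        have := h' _ _ hw _ hz
        rw [Stream'.append_append_stream] at this
        exact absurd ⟨_, this⟩ (hpt _)
    · obtain ⟨u, w, v, rfl, rfl, hw⟩ := hs.isPrefixLocal x y hxy
      obtain ⟨k, hk⟩ := ht.1.2 u
      have := h' _ _ hw _ (append_mem_eventuallyZero (u := k).2 hz)
      rw [← Stream'.append_append_stream] at this
      exact absurd ⟨_, this⟩ (hk _)
  · exact h x (hs.1.1 ⟨y, hxy⟩) y (hs.2.1 ⟨x, maps_inv.2 hxy⟩) hxy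

/-! ### `E`-disjunctivity -/

theorem exists_mem_thompsonV_apply_eq_zero {x : Cantor} (hx : x ∈ eventuallyZero) :
    ∃ f : Equiv.Perm Cantor, ofPerm f ∈ thompsonInverseMonoid.toSubmonoid ∧
      f x = Stream'.const false := by
  obtain ⟨u, rfl⟩ := hx
  have hz : List.replicate u.length false ++ₛ Stream'.const false = Stream'.const false := by
    generalize u.length = n
    induction n with
    | zero => rfl
    | succ n ih =>
      rw [List.replicate_succ, Stream'.cons_append_stream, ih, ← Stream'.const_eq]
  by_cases hu : u = List.replicate u.length false
  · refine ⟨1, ofPerm_one ▸ one_mem _, ?_⟩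
    rw [hu]
    exact hz
  -- Padding `0^ω` to a prefix of the same length as `u` makes two distinct words incomparable, so
  -- their swap exists.
  · have hi := incomparable_of_length_eq (by simp) hu
    obtain ⟨g, hg⟩ := hi.exists_isConeSwap
    exact ⟨g, ofPerm_mem_thompsonInverseMonoid (hg.mem_thompsonV hi), by rw [hg.1, hz]⟩

/-- The swap of the two halves serves twice: it conjugates the idempotent on `1ℭ` to the one on
`0ℭ`, and it destroys idempotency of rank-one maps. -/
theorem exists_fixedPointFree_mem_thompsonInverseMonoid :
    ∃ f : Equiv.Perm Cantor, ofPerm f ∈ thompsonInverseMonoid.toSubmonoid ∧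
      (∀ x, f x ≠ x) ∧ f ⁻¹' cone [true] = cone [false] := by
  have hi : Incomparable [false] [true] := incomparable_of_length_eq rfl (by simp)
  obtain ⟨g, hg⟩ := hi.exists_isConeSwap
  have hx : ∀ x : Cantor, x = [false] ++ₛ x.tail ∨ x = [true] ++ₛ x.tail := fun x => by
    have := (Stream'.append_stream_head_tail x).symm
    cases hh : x.head
    · exact Or.inl (by rwa [hh] at this)
    · exact Or.inr (by rwa [hh] at this)
  refine ⟨g, ofPerm_mem_thompsonInverseMonoid (hg.mem_thompsonV hi), fun x e => ?_, ?_⟩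
  · rcases hx x with h | h
    · have h1 : g x = [true] ++ₛ x.tail := by
        conv_lhs => rw [h]
        exact hg.1 _
      exact hi.not_mem_cone ⟨_, h⟩ ⟨_, e.symm.trans h1⟩
    · have h1 : g x = [false] ++ₛ x.tail := by
        conv_lhs => rw [h]
        exact hg.2.1 _
      exact hi.not_mem_cone ⟨_, e.symm.trans h1⟩ ⟨_, h⟩
  · ext x
    constructor
    · intro h
      rcases hx x with h1 | h1
      · exact ⟨_, h1⟩
      · exfalso
        rw [Set.mem_preimage, h1, hg.2.1] at h
        exact hi.not_mem_cone (append_mem_cone _ _) h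
    · rintro ⟨v, rfl⟩
      exact ⟨v, hg.1 v⟩

/-- The only `1ⁿ0^ω` in `0ℭ` is `0^ω`, and every other eventually zero point is reached by
conjugating with an element of `V`. -/
theorem idOn_singleton_mem_thompsonInverseMonoid {x : Cantor} (hx : x ∈ eventuallyZero) :
    idOn {x} ∈ thompsonInverseMonoid.toSubmonoid := by
  have h0 : idOn {Stream'.const false} ∈ thompsonInverseMonoid.toSubmonoid := by
    obtain ⟨g, hg, -, hgc⟩ := exists_fixedPointFree_mem_thompsonInverseMonoid
    have h1 : ({Stream'.const false} : Set Cantor) = onesThenZeros ∩ cone [false] := by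
      ext x
      constructor
      · rintro rfl
        exact ⟨⟨0, rfl⟩, ⟨_, Stream'.const_eq false⟩⟩
      · rintro ⟨⟨n, rfl⟩, v, hv⟩
        cases n with
        | zero => rfl
        | succ n => exact absurd (congrArg Stream'.head hv) (by simp [List.replicate_succ])
    rw [h1, ← idOn_mul_idOn, ← hgc, ← conj_idOn]
    exact mul_mem idOn_onesThenZeros_mem_thompsonInverseMonoid (mul_mem (mul_mem hg
      idOn_cone_true_mem_thompsonInverseMonoid) (thompsonInverseMonoid.inv_mem' _ hg))
  obtain ⟨f, hf, hfx⟩ := exists_mem_thompsonV_apply_eq_zero hx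
  have h1 : ({x} : Set Cantor) = f ⁻¹' {Stream'.const false} := by
    ext y
    rw [Set.mem_preimage, Set.mem_singleton_iff, Set.mem_singleton_iff, ← hfx,
      f.injective.eq_iff]
  rw [h1, ← conj_idOn]
  exact mul_mem (mul_mem hf h0) (thompsonInverseMonoid.inv_mem' _ hf)

theorem IsIdempotentPure.eq_of_maps {c : Con thompsonInverseMonoid.toSubmonoid}
    (hc : IsIdempotentPure c) {s t : thompsonInverseMonoid.toSubmonoid} (hst : c s t)
    (ht : ∀ x y, ¬ (t : SymInvMonoid Cantor).Maps x y) {x y : Cantor}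
    (hs : (s : SymInvMonoid Cantor).Maps x y) : x = y := by
  have hti : IsIdempotentElem t := Subtype.ext (isIdempotentElem_of_forall_not_maps ht)
  have hsi : IsIdempotentElem s := hc s t hst hti
  exact eq_of_maps_of_isIdempotentElem (congrArg Subtype.val hsi) hs

theorem IsIdempotentPure.maps_of_maps {c : Con thompsonInverseMonoid.toSubmonoid}
    (hc : IsIdempotentPure c) {s t : thompsonInverseMonoid.toSubmonoid} (hst : c s t)
    {x y : Cantor} (hx : x ∈ eventuallyZero) (hy : y ∈ eventuallyZero)
    (h : (s : SymInvMonoid Cantor).Maps x y) : (t : SymInvMonoid Cantor).Maps x y := by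
  by_contra ht
  let p : thompsonInverseMonoid.toSubmonoid := ⟨_, idOn_singleton_mem_thompsonInverseMonoid hx⟩
  let q : thompsonInverseMonoid.toSubmonoid := ⟨_, idOn_singleton_mem_thompsonInverseMonoid hy⟩
  -- The point idempotents cut `s` down to the single pair `(x, y)` and `t` down to the empty map.
  have hpq : c (p * s * q) (p * t * q) := c.mul (c.mul (c.refl p) hst) (c.refl q)
  have h1 : ((p * s * q : thompsonInverseMonoid.toSubmonoid) : SymInvMonoid Cantor).Maps x y :=
    maps_mul.2 ⟨y, maps_mul.2 ⟨x, maps_idOn.2 ⟨rfl, rfl⟩, h⟩, maps_idOn.2 ⟨rfl, rfl⟩⟩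
  have h2 : ∀ a b,
      ¬ ((p * t * q : thompsonInverseMonoid.toSubmonoid) : SymInvMonoid Cantor).Maps a b := by
    intro a b hab
    obtain ⟨d, had, hdb⟩ := maps_mul.1 hab
    obtain ⟨e, hae, hed⟩ := maps_mul.1 had
    obtain ⟨rfl, rfl⟩ := maps_idOn.1 hae
    obtain ⟨rfl, rfl⟩ := maps_idOn.1 hdb
    exact ht hed
  obtain ⟨f, hf, hfx, -⟩ := exists_fixedPointFree_mem_thompsonInverseMonoid
  let g : thompsonInverseMonoid.toSubmonoid := ⟨_, hf⟩
  -- Purity makes both `x ↦ y` and its twist `x ↦ f y` restrictions of the identity, so `f` would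
  -- fix `y`.
  have h3 := hc.eq_of_maps hpq h2 h1
  have h4 : x = f y := hc.eq_of_maps (c.mul hpq (c.refl g))
    (fun a b hab => (maps_mul.1 hab).elim fun d hd => h2 a d hd.1)
    (maps_mul.2 ⟨y, h1, maps_ofPerm.2 rfl⟩)
  exact hfx y (h4.symm.trans h3)

theorem isEDisjunctive_thompsonInverseMonoid :
    IsEDisjunctive thompsonInverseMonoid.toSubmonoid := by
  intro c hc
  refine le_bot_iff.1 fun s t (hst : c s t) => ?_
  have hs := isClopenType_or_isThinType s.2
  have ht := isClopenType_or_isThinType t.2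
  exact Subtype.ext <| ext_maps fun x y =>
    ⟨maps_of_maps_on_eventuallyZero hs ht fun x hx y hy => hc.maps_of_maps hst hx hy,
      maps_of_maps_on_eventuallyZero ht hs fun x hx y hy => hc.maps_of_maps (c.symm hst) hx hy⟩

theorem mainTheorem11 :
    InverseMonoid.FinitelyGenerated thompsonInverseMonoid.toSubmonoid ∧
      IsEDisjunctive thompsonInverseMonoid.toSubmonoid ∧
      Infinite (JClasses thompsonInverseMonoid.toSubmonoid) :=
  ⟨finitelyGenerated_thompsonInverseMonoid, isEDisjunctive_thompsonInverseMonoid,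
    infinite_jClasses_thompsonInverseMonoid⟩
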